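/- Throughout, $R$ is a commutative Noetherian local ring. A finitely generated $R$-module $M$ is a \emph{test module} if every finitely generated $R$-module $N$ with $\operatorname{pd}(N)=\infty$ satisfies $\operatorname{Tor}_n^R(M,N)\neq 0$ for infinitely many $n$. A finitely generated $R$-module $C$ is \emph{semidualizing} if the homothety map $R\to\operatorname{Hom}_R(C,C)$ is bijective and $\operatorname{Ext}^i_R(C,C)=0$ for all $i\geq 1$. For such $C$ and a nonzero finitely generated module $M$, $C\text{-}\operatorname{id}(M)$ is the infimum of the integers $n\ge 0$ for which there is an exact sequence $$0\to M\to \operatorname{Hom}_R(C,I^0)\to \operatorname{Hom}_R(C,I^1)\to\cdots\to \operatorname{Hom}_R(C,I^n)\to 0$$ with every $I^j$ an injective $R$-module. A finitely generated module $G$ is \emph{totally reflexive} if the canonical map $G\to G^{**}$, where $(-)^*=\operatorname{Hom}_R(-,R)$, is bijective and $\operatorname{Ext}^i_R(G,R)=0=\operatorname{Ext}^i_R(G^*,R)$ for all $i\geq 1$; the Gorenstein dimension $\operatorname{G-dim}(M)$ of a nonzero finitely generated module $M$ is the infimum of the lengths $n$ of exact sequences $0\to G_n\to\cdots\to G_0\to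 M\to 0$ with every $G_j$ totally reflexive, and $\operatorname{G-dim}(0)=\operatorname{pd}(0)=-\infty$. The ring $R$ is \emph{G-regular} if $\operatorname{G-dim}(M)=\operatorname{pd}(M)$ for all finitely generated $R$-modules $M$. (1) Let $C$ be a semidualizing $R$-module and let $M$ be a nonzero test module over $R$ with $C\text{-}\operatorname{id}(M)<\infty$. If $X$ is a finitely generated $R$-module such that $\operatorname{Ext}^i_R(X,R)=0$ for all $i\gg 0$, then $\operatorname{pd}(X)<\infty$. (2) If $R$ admits a nonzero test module of finite injective dimension, then $R$ is G-regular. -/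

import Mathlib

open CategoryTheory CategoryTheory.Limits

universe u

noncomputable section

/-- A finitely generated module `M` is a test module (for projectivity) if every finitely generated
`N` of infinite projective dimension has `Tor_n(M, N) ≠ 0` for infinitely many `n`. -/
structure IsTestModule {R : Type u} [CommRing R] (M : ModuleCat.{u} R) : Prop where
  finite : Module.Finite R M
  infinite_tor : ∀ N : ModuleCat.{u} R, Module.Finite R N → projectiveDimension N = ⊤ →
    {n : ℕ | ¬ IsZero (((Tor (ModuleCat.{u} R) n).obj M).obj N)}.Infinite

/-- A finitely generated module `C` is semidualizing if the homothety map `R → Hom(C, C)` is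
bijective and `Ext^i(C, C) = 0` for all `i ≥ 1`. -/
structure IsSemidualizing {R : Type u} [CommRing R] (C : ModuleCat.{u} R) : Prop where
  finite : Module.Finite R C
  bijective_homothety : Function.Bijective (LinearMap.lsmul R C)
  ext_vanishing : ∀ i : ℕ, 1 ≤ i → Subsingleton (Abelian.Ext C C i)

/-- There is an exact sequence `0 → M → Hom(C, I 0) → Hom(C, I 1) → ⋯ → Hom(C, I n) → 0`
with every `I i` injective (it is continued by the zero modules `I i`, `i > n`). -/
def HasCInjectiveDimensionLE {R : Type u} [CommRing R] (C M : ModuleCat.{u} R) (n : ℕ) : Prop :=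
  ∃ (I : ℕ → ModuleCat.{u} R) (ε : M →ₗ[R] (C →ₗ[R] I 0))
    (d : ∀ i : ℕ, (C →ₗ[R] I i) →ₗ[R] (C →ₗ[R] I (i + 1))),
    (∀ i, Injective (I i)) ∧ (∀ i, n < i → Subsingleton (I i)) ∧
    Function.Injective ε ∧ Function.Exact ε (d 0) ∧
    ∀ i, Function.Exact (d i) (d (i + 1))

/-- The `C`-injective dimension `C-id(M)` of a (nonzero) module `M`: the least `n` for which `M`
has a coresolution of length `n` by modules `Hom(C, I)` with `I` injective, and `⊤` if there is
no such `n`. -/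
def cInjectiveDimension {R : Type u} [CommRing R] (C M : ModuleCat.{u} R) : ℕ∞ :=
  ⨅ (n : ℕ) (_ : HasCInjectiveDimensionLE C M n), (n : ℕ∞)

/-- A finitely generated module `M` is totally reflexive if the biduality map `M → M**` is
bijective and `Ext^i(M, R) = 0 = Ext^i(M*, R)` for all `i ≥ 1`. -/
structure IsTotallyReflexive {R : Type u} [CommRing R] (M : ModuleCat.{u} R) : Prop where
  finite : Module.Finite R M
  bijective_biduality : Function.Bijective (Module.Dual.eval R M)
  ext_vanishing : ∀ i : ℕ, 1 ≤ i → Subsingleton (Abelian.Ext M (ModuleCat.of R R) i)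
  ext_dual_vanishing : ∀ i : ℕ, 1 ≤ i →
    Subsingleton (Abelian.Ext (ModuleCat.of R (Module.Dual R M)) (ModuleCat.of R R) i)

/-- There is an exact sequence `0 → X n → ⋯ → X 1 → X 0 → M → 0` with every `X i` totally
reflexive (it is continued by the zero modules `X i`, `i > n`). -/
def HasGDimensionLE {R : Type u} [CommRing R] (M : ModuleCat.{u} R) (n : ℕ) : Prop :=
  ∃ (X : ℕ → ModuleCat.{u} R) (ε : X 0 →ₗ[R] M) (d : ∀ i : ℕ, X (i + 1) →ₗ[R] X i),
    (∀ i, IsTotallyReflexive (X i)) ∧ (∀ i, n < i → Subsingleton (X i)) ∧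
    Function.Surjective ε ∧ Function.Exact (d 0) ε ∧
    ∀ i, Function.Exact (d (i + 1)) (d i)

open Classical in
/-- The Gorenstein dimension of a finitely generated module; as for Mathlib's
`projectiveDimension`, the value at the zero module is `⊥` (that is, `-∞`). -/
def gDimension {R : Type u} [CommRing R] (M : ModuleCat.{u} R) : WithBot ℕ∞ :=
  if Subsingleton M then ⊥
  else ((⨅ (n : ℕ) (_ : HasGDimensionLE M n), (n : ℕ∞) : ℕ∞) : WithBot ℕ∞)

/-- `R` is G-regular if `G-dim(M) = pd(M)` for all finitely generated modules `M`. -/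
def IsGRegular (R : Type u) [CommRing R] : Prop :=
  ∀ M : ModuleCat.{u} R, Module.Finite R M → gDimension M = projectiveDimension M

end

/-! Everything rests on one duality: for a finite free complex `F`, `Hom(C, I) ⊗ F ≅ Hom(Hom(F, C),
I)`, naturally in `F`. It turns vanishing of Ext into vanishing of Tor, to which the test property
applies.

With `F` the finite free resolution of `C` and `I` injective, `Ext^i(C, C) = 0` makes `Hom(F, C)`,
hence `Hom(C, I) ⊗ F`, exact in positive degrees. Dimension shifting along the coresolution of `M`
by modules `Hom(C, I)` gives `Tor_i(M, C) = 0` for `i ≥ 1`, so `pd(C) < ∞` because `M` is a test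
module. Over a local ring a nonzero finite module detects finite projective dimension as the last
nonvanishing Ext, so `Ext^i(C, C) = 0` forces `C` to be projective
(`IsSemidualizing.projective_of_isTestModule`). Then each `Hom(C, I)` is injective and `M` has
finite injective dimension.

Now let `T` be a test module of finite injective dimension and `F` the resolution of `X`. Since `T ⊗
F ≅ Hom(Hom(F, R), T)`, and `Hom(F, R)` consists of projectives and is exact in high degrees, `T ⊗
F` is also exact there and `pd(X) < ∞` (`IsTestModule.projectiveDimension_lt_top_of_ext`). This is
(1).

For (2), finite G-dimension `k` kills `Ext^i(M, R)` for `i > k`, so `pd(M)` is finite and hence at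
most `k`. The other inequality holds because finite projectives are totally reflexive. -/

/-! ### Tensor-Hom duality and dimension shifting for exactness -/

section ModuleLemmas

variable {R : Type u} [CommRing R]

/-- The map `M ⊗ F → Hom(Hom(F, C), I)`, `m ⊗ x ↦ (g ↦ e m (g x))`, for `e : M ≃ Hom(C, I)`. -/
noncomputable def tensorHomHom {M C I : Type u} [AddCommGroup M] [Module R M]
    [AddCommGroup C] [Module R C] [AddCommGroup I] [Module R I] (e : M ≃ₗ[R] (C →ₗ[R] I))
    (F : Type u) [AddCommGroup F] [Module R F] :
    TensorProduct R M F →ₗ[R] ((F →ₗ[R] C) →ₗ[R] I) :=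
  TensorProduct.lift
    { toFun m :=
        { toFun x := e m ∘ₗ LinearMap.applyₗ x
          map_add' x y := by ext; simp
          map_smul' r x := by ext; simp }
      map_add' m n := by ext; simp
      map_smul' r m := by ext; simp }

@[simp]
lemma tensorHomHom_tmul {M C I : Type u} [AddCommGroup M] [Module R M]
    [AddCommGroup C] [Module R C] [AddCommGroup I] [Module R I] (e : M ≃ₗ[R] (C →ₗ[R] I))
    (F : Type u) [AddCommGroup F] [Module R F] (m : M) (x : F) (g : F →ₗ[R] C) :
    tensorHomHom e F (TensorProduct.tmul R m x) g = e m (g x) := rfl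

lemma tensorHomHom_bijective {M C I : Type u} [AddCommGroup M] [Module R M]
    [AddCommGroup C] [Module R C] [AddCommGroup I] [Module R I] (e : M ≃ₗ[R] (C →ₗ[R] I))
    (n : ℕ) : Function.Bijective (tensorHomHom e (Fin n → R)) := by
  let e₁ : TensorProduct R M (Fin n → R) ≃ₗ[R] (Fin n → M) :=
    TensorProduct.piScalarRight R R M (Fin n)
  let e₂ : (Fin n → M) ≃ₗ[R] (Fin n → (C →ₗ[R] I)) := LinearEquiv.piCongrRight fun _ => e
  let e₃ : (Fin n → (C →ₗ[R] I)) ≃ₗ[R] ((Fin n → C) →ₗ[R] I) :=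
    LinearMap.lsum R (fun _ : Fin n => C) R
  let e₄ : ((Fin n → C) →ₗ[R] I) ≃ₗ[R] (((Fin n → R) →ₗ[R] C) →ₗ[R] I) :=
    LinearEquiv.congrLeft I R ((Pi.basisFun R (Fin n)).constr R)
  -- It suffices to compare both sides on tensors of `m` with a standard basis vector.
  have h : tensorHomHom e (Fin n → R) = (e₁ ≪≫ₗ e₂ ≪≫ₗ e₃ ≪≫ₗ e₄).toLinearMap := by
    ext m i g
    simp only [LinearMap.coe_comp, Function.comp_apply, LinearMap.coe_single,
      TensorProduct.AlgebraTensorModule.curry_apply, LinearMap.restrictScalars_self,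
      TensorProduct.curry_apply, tensorHomHom_tmul]
    simp only [e₁, e₂, e₃, e₄, LinearEquiv.congrLeft, Pi.single_apply, LinearEquiv.coe_coe,
      LinearEquiv.trans_apply, TensorProduct.piScalarRight_apply,
      TensorProduct.piScalarRightHom_tmul, ite_smul, one_smul,
      zero_smul]
    simp
    rw [Finset.sum_eq_single i]
    · simp
    · intro j _ hj
      simp [hj]
    · simp
  rw [h]
  exact LinearEquiv.bijective _

/-- `tensorHomHom` is natural in the free module, so exactness transports along it. `I` is arbitrary
here: the lemma serves both `M = Hom(C, I)` with `I` injective and `M = Hom(R, M)`. -/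
lemma lTensor_exact_of_exact_lcomp {M C I : Type u} [AddCommGroup M] [Module R M]
    [AddCommGroup C] [Module R C] [AddCommGroup I] [Module R I] (e : M ≃ₗ[R] (C →ₗ[R] I))
    {a b c : ℕ} (f : (Fin a → R) →ₗ[R] (Fin b → R)) (g : (Fin b → R) →ₗ[R] (Fin c → R))
    (h : Function.Exact (LinearMap.lcomp R I (LinearMap.lcomp R C f))
      (LinearMap.lcomp R I (LinearMap.lcomp R C g))) :
    Function.Exact (f.lTensor M) (g.lTensor M) := by
  refine Function.Exact.of_ladder_linearEquiv_of_exact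
    (e₁ := (LinearEquiv.ofBijective _ (tensorHomHom_bijective e a)).symm)
    (e₂ := (LinearEquiv.ofBijective _ (tensorHomHom_bijective e b)).symm)
    (e₃ := (LinearEquiv.ofBijective _ (tensorHomHom_bijective e c)).symm) ?_ ?_ h
  · ext x : 1
    obtain ⟨x, rfl⟩ := (LinearEquiv.ofBijective _ (tensorHomHom_bijective e a)).surjective x
    simp only [LinearMap.comp_apply, LinearEquiv.coe_coe, LinearEquiv.symm_apply_apply,
      LinearEquiv.eq_symm_apply]
    induction x with
    | zero => simp
    | tmul m x => ext; simp
    | add x y hx hy => simp only [map_add, hx, hy]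
  · ext x : 1
    obtain ⟨x, rfl⟩ := (LinearEquiv.ofBijective _ (tensorHomHom_bijective e b)).surjective x
    simp only [LinearMap.comp_apply, LinearEquiv.coe_coe, LinearEquiv.symm_apply_apply,
      LinearEquiv.eq_symm_apply]
    induction x with
    | zero => simp
    | tmul m x => ext; simp
    | add x y hx hy => simp only [map_add, hx, hy]

/-- `Hom(-, I)` preserves exactness for `I` injective. -/
lemma exact_lcomp_of_injective {A B D I : Type u} [AddCommGroup A] [Module R A]
    [AddCommGroup B] [Module R B] [AddCommGroup D] [Module R D] [AddCommGroup I] [Module R I]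
    [Module.Injective R I] {f : A →ₗ[R] B} {g : B →ₗ[R] D} (h : Function.Exact f g) :
    Function.Exact (LinearMap.lcomp R I g) (LinearMap.lcomp R I f) := by
  intro φ
  constructor
  · intro hφ
    have hk : LinearMap.ker g ≤ LinearMap.ker φ := by
      intro x hx
      obtain ⟨y, rfl⟩ := (h x).1 hx
      exact LinearMap.congr_fun hφ y
    -- `B / ker g` embeds in `D`, and `φ` descends to this quotient.
    obtain ⟨ψ, hψ⟩ := Module.Injective.out (Submodule.liftQ _ g le_rfl)
      (LinearMap.ker_eq_bot.1 (Submodule.ker_liftQ_eq_bot _ _ _ le_rfl))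
      (Submodule.liftQ _ φ hk)
    refine ⟨ψ, ?_⟩
    ext x
    simpa using hψ (Submodule.Quotient.mk x)
  · rintro ⟨ψ, rfl⟩
    ext x
    simp [h.apply_apply_eq_zero]

/-- If `0 → M → W → M' → 0` is exact and `Hom(G, W)`, `Hom(G, M')` are exact in the degrees
from `a` on, so is `Hom(G, M)`. -/
lemma exact_lcomp_of_short_exact {G : ℕ → Type u} [∀ i, AddCommGroup (G i)]
    [∀ i, Module R (G i)] [∀ i, Module.Projective R (G i)] (d : ∀ i, G i →ₗ[R] G (i + 1)) (a : ℕ)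
    {M W M' : Type u} [AddCommGroup M] [Module R M] [AddCommGroup W] [Module R W]
    [AddCommGroup M'] [Module R M'] {f : M →ₗ[R] W} {g : W →ₗ[R] M'}
    (hd : ∀ i, a ≤ i → Function.Exact (d i) (d (i + 1)))
    (hf : Function.Injective f) (hfg : Function.Exact f g) (hg : Function.Surjective g)
    (hW : ∀ i, a ≤ i →
      Function.Exact (LinearMap.lcomp R W (d (i + 1))) (LinearMap.lcomp R W (d i)))
    (hM' : ∀ i, a ≤ i →
      Function.Exact (LinearMap.lcomp R M' (d (i + 1))) (LinearMap.lcomp R M' (d i)))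
    (i : ℕ) (hi : a ≤ i) :
    Function.Exact (LinearMap.lcomp R M (d (i + 1))) (LinearMap.lcomp R M (d i)) := by
  intro φ
  constructor
  · intro hφ
    have h1 : LinearMap.lcomp R W (d i) (f ∘ₗ φ) = 0 := by
      ext x
      simpa using congrArg f (LinearMap.congr_fun hφ x)
    obtain ⟨ψ, hψ⟩ := (hW i hi _).1 h1
    have h2 : LinearMap.lcomp R M' (d (i + 1)) (g ∘ₗ ψ) = 0 := by
      ext x
      have := congrArg g (LinearMap.congr_fun hψ x)
      simpa [hfg.apply_apply_eq_zero] using this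
    -- `M'` is used one degree higher, as with a connecting map, so the bound `a` does not change.
    -- Subtracting a lift of `θ` moves `ψ` into the image of `f` without changing its restriction
    -- along `d (i + 1)`.
    obtain ⟨θ, hθ⟩ := (hM' (i + 1) (by omega) _).1 h2
    obtain ⟨θ', hθ'⟩ := Module.projective_lifting_property g θ hg
    have h3 : ∀ x, (ψ - θ' ∘ₗ d (i + 1 + 1)) x ∈ LinearMap.range f := by
      intro x
      rw [LinearMap.mem_range]
      refine (hfg _).1 ?_
      have e1 := LinearMap.congr_fun hθ x
      have e2 := LinearMap.congr_fun hθ' (d (i + 1 + 1) x)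
      simp only [LinearMap.lcomp_apply, LinearMap.comp_apply] at e1 e2
      simp [e2, e1]
    refine ⟨(LinearEquiv.ofInjective f hf).symm.toLinearMap ∘ₗ
      LinearMap.codRestrict (LinearMap.range f) _ h3, ?_⟩
    ext x
    apply hf
    have e3 := LinearMap.congr_fun hψ x
    simp only [LinearMap.lcomp_apply, LinearMap.comp_apply, LinearEquiv.coe_coe] at e3 ⊢
    rw [← LinearEquiv.ofInjective_apply (h := hf), LinearEquiv.apply_symm_apply]
    simp [e3, (hd (i + 1) (by omega)).apply_apply_eq_zero]
  · rintro ⟨ψ, rfl⟩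
    ext x
    simp [(hd i hi).apply_apply_eq_zero]

/-- If `0 → M → W → M' → 0` is exact and `W ⊗ F`, `M' ⊗ F` are exact in positive degrees, then so
is `M ⊗ F`, for `F` a complex of flat modules. -/
lemma exact_lTensor_of_short_exact {F : ℕ → Type u} [∀ i, AddCommGroup (F i)]
    [∀ i, Module R (F i)] [∀ i, Module.Flat R (F i)] (d : ∀ i, F (i + 1) →ₗ[R] F i)
    {M W M' : Type u} [AddCommGroup M] [Module R M] [AddCommGroup W] [Module R W]
    [AddCommGroup M'] [Module R M'] {f : M →ₗ[R] W} {g : W →ₗ[R] M'}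
    (hd : ∀ i, Function.Exact (d (i + 1)) (d i))
    (hf : Function.Injective f) (hfg : Function.Exact f g) (hg : Function.Surjective g)
    (hW : ∀ i, Function.Exact ((d (i + 1)).lTensor W) ((d i).lTensor W))
    (hM' : ∀ i, Function.Exact ((d (i + 1)).lTensor M') ((d i).lTensor M')) (i : ℕ) :
    Function.Exact ((d (i + 1)).lTensor M) ((d i).lTensor M) := by
  have comm {A B : Type u} [AddCommGroup A] [Module R A] [AddCommGroup B] [Module R B]
      (p : A →ₗ[R] B) (j : ℕ) (x : TensorProduct R A (F (j + 1))) :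
      p.rTensor (F j) ((d j).lTensor A x) = (d j).lTensor B (p.rTensor (F (j + 1)) x) := by
    rw [← LinearMap.comp_apply, ← LinearMap.comp_apply, LinearMap.rTensor_comp_lTensor,
      LinearMap.lTensor_comp_rTensor]
  have dd (A : Type u) [AddCommGroup A] [Module R A] (j : ℕ)
      (x : TensorProduct R A (F (j + 1 + 1))) :
      (d j).lTensor A ((d (j + 1)).lTensor A x) = 0 := by
    rw [← LinearMap.comp_apply, ← LinearMap.lTensor_comp, (hd j).linearMap_comp_eq_zero]
    simp
  have inj (j : ℕ) : Function.Injective (f.rTensor (F j)) :=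
    Module.Flat.rTensor_preserves_injective_linearMap f hf
  have ex (j : ℕ) : Function.Exact (f.rTensor (F j)) (g.rTensor (F j)) :=
    rTensor_exact (F j) hfg hg
  intro x
  constructor
  · intro hx
    obtain ⟨y, hy⟩ := (hW i (f.rTensor _ x)).1 (by rw [← comm, hx, map_zero])
    obtain ⟨z, hz⟩ := (hM' (i + 1) (g.rTensor _ y)).1 (by
      rw [← comm, hy, (ex _).apply_apply_eq_zero])
    obtain ⟨z, rfl⟩ := LinearMap.rTensor_surjective (F (i + 1 + 1 + 1)) hg z
    obtain ⟨w, hw⟩ := (ex _ (y - (d (i + 1 + 1)).lTensor W z)).1 (by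
      rw [map_sub, comm, hz, sub_self])
    refine ⟨w, inj _ ?_⟩
    rw [comm, hw, map_sub, hy, dd, sub_zero]
  · rintro ⟨y, rfl⟩
    exact dd _ _ _

/-- Induction along a finite coresolution. -/
lemma coresolution_induction {P Q : ModuleCat.{u} R → Prop}
    (hzero : ∀ M : ModuleCat.{u} R, Subsingleton M → P M)
    (hstep : ∀ (M W M' : ModuleCat.{u} R) (f : M →ₗ[R] W) (g : W →ₗ[R] M'),
      Function.Injective f → Function.Exact f g → Function.Surjective g → Q W → P M' → P M)
    (n : ℕ) : ∀ (M : ModuleCat.{u} R) (W : ℕ → ModuleCat.{u} R) (ε : M →ₗ[R] W 0)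
    (d : ∀ i, W i →ₗ[R] W (i + 1)), (∀ i, Q (W i)) → (∀ i, n ≤ i → Subsingleton (W i)) →
    Function.Injective ε → Function.Exact ε (d 0) →
    (∀ i, Function.Exact (d i) (d (i + 1))) → P M := by
  induction n with
  | zero =>
    intro M W ε d _ h0 hε _ _
    have := h0 0 le_rfl
    exact hzero M hε.subsingleton
  | succ n ih =>
    intro M W ε d hQ h0 hε hε0 hd
    -- The image of `d 0` is the cokernel of `ε` and has a coresolution shorter by one.
    refine hstep M (W 0) (ModuleCat.of R (LinearMap.range (d 0))) ε (d 0).rangeRestrict hε ?_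
      (LinearMap.surjective_rangeRestrict _) (hQ 0) ?_
    · intro x
      rw [← hε0 x, ← Subtype.coe_inj]
      simp
    · refine ih _ (fun i => W (i + 1)) (LinearMap.range (d 0)).subtype (fun i => d (i + 1))
        (fun i => hQ _) (fun i hi => h0 _ (by omega)) (Submodule.subtype_injective _) ?_
        (fun i => hd _)
      intro x
      rw [hd 0 x]
      simp

end ModuleLemmas

/-! ### Explicit resolutions by finite free modules -/

section FreeResolution

variable {R : Type u} [CommRing R]

/-- The rank of the chosen finite free cover of a finite module. -/
noncomputable def coverRank (R : Type u) [CommRing R] (M : Type u) [AddCommGroup M] [Module R M]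
    [Module.Finite R M] : ℕ :=
  (Module.Finite.exists_fin' R M).choose

/-- A finite free cover of a finite module. -/
noncomputable def freeCover (R : Type u) [CommRing R] (M : Type u) [AddCommGroup M] [Module R M]
    [Module.Finite R M] : (Fin (coverRank R M) → R) →ₗ[R] M :=
  (Module.Finite.exists_fin' R M).choose_spec.choose

lemma freeCover_surjective (M : Type u) [AddCommGroup M] [Module R M] [Module.Finite R M] :
    Function.Surjective (freeCover R M) :=
  (Module.Finite.exists_fin' R M).choose_spec.choose_spec

lemma freeCover_shortExact (M : ModuleCat.{u} R) [Module.Finite R M] :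
    (freeCover R M).shortComplexKer.ShortExact :=
  LinearMap.shortExact_shortComplexKer (freeCover_surjective (M : Type u))

instance (M : ModuleCat.{u} R) [Module.Finite R M] :
    Projective (freeCover R M).shortComplexKer.X₂ :=
  inferInstanceAs (Projective (ModuleCat.of R (Fin (coverRank R M) → R)))

variable [IsNoetherianRing R]

/-- The iterated syzygies of a finite module over a Noetherian ring. -/
noncomputable def finiteSyzygy (M : ModuleCat.{u} R) (hM : Module.Finite R M) :
    ℕ → {N : ModuleCat.{u} R // Module.Finite R N}
  | 0 => ⟨M, hM⟩
  | n + 1 =>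
    let N := finiteSyzygy M hM n
    haveI := N.2
    ⟨ModuleCat.of R (LinearMap.ker (freeCover R N.1)), inferInstance⟩

variable (M : ModuleCat.{u} R) [hM : Module.Finite R M]

instance finite_finiteSyzygy (n : ℕ) : Module.Finite R (finiteSyzygy M hM n).1 :=
  (finiteSyzygy M hM n).2

/-- The ranks of the free modules in a resolution of a finite module. -/
noncomputable def resolutionRank (n : ℕ) : ℕ := coverRank R (finiteSyzygy M hM n).1

/-- The augmentations of the free modules in a resolution to the syzygies. -/
noncomputable def resolutionAug (n : ℕ) :
    (Fin (resolutionRank M n) → R) →ₗ[R] (finiteSyzygy M hM n).1 :=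
  freeCover R (finiteSyzygy M hM n).1

/-- The inclusions of the syzygies in the free modules of a resolution. -/
noncomputable def resolutionIncl (n : ℕ) :
    (finiteSyzygy M hM (n + 1)).1 →ₗ[R] (Fin (resolutionRank M n) → R) :=
  (LinearMap.ker (freeCover R (finiteSyzygy M hM n).1)).subtype

/-- The differentials of a resolution of a finite module by finite free modules. -/
noncomputable def resolutionD (n : ℕ) :
    (Fin (resolutionRank M (n + 1)) → R) →ₗ[R] (Fin (resolutionRank M n) → R) :=
  resolutionIncl M n ∘ₗ resolutionAug M (n + 1)

lemma resolutionAug_surjective (n : ℕ) : Function.Surjective (resolutionAug M n) :=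
  freeCover_surjective _

lemma resolutionIncl_injective (n : ℕ) : Function.Injective (resolutionIncl M n) :=
  Submodule.subtype_injective _

lemma exact_resolutionIncl_resolutionAug (n : ℕ) :
    Function.Exact (resolutionIncl M n) (resolutionAug M n) :=
  LinearMap.exact_subtype_ker_map _

lemma exact_resolutionD_resolutionAug (n : ℕ) :
    Function.Exact (resolutionD M n) (resolutionAug M n) := by
  intro x
  rw [exact_resolutionIncl_resolutionAug M n x, resolutionD, LinearMap.coe_comp,
    (resolutionAug_surjective M (n + 1)).range_comp]

lemma exact_resolutionD (n : ℕ) : Function.Exact (resolutionD M (n + 1)) (resolutionD M n) := by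
  intro x
  rw [← exact_resolutionD_resolutionAug M (n + 1) x, resolutionD, LinearMap.comp_apply,
    map_eq_zero_iff _ (resolutionIncl_injective M n)]

/-- The finite free resolution as a chain complex. -/
noncomputable def resolutionComplex : ChainComplex (ModuleCat.{u} R) ℕ :=
  ChainComplex.of (fun n => ModuleCat.of R (Fin (resolutionRank M n) → R))
    (fun n => ModuleCat.ofHom (resolutionD M n))
    (fun n => by
      rw [← ModuleCat.ofHom_comp, (exact_resolutionD M n).linearMap_comp_eq_zero]; rfl)

lemma resolutionComplex_d (n : ℕ) :
    ((resolutionComplex M).d (n + 1) n).hom = resolutionD M n :=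
  congrArg ModuleCat.Hom.hom (ChainComplex.of_d
    (fun n => ModuleCat.of R (Fin (resolutionRank M n) → R))
    (fun n => ModuleCat.ofHom (resolutionD M n)) n)

lemma exact_resolutionComplex_d (n : ℕ) :
    Function.Exact ((resolutionComplex M).d (n + 1 + 1) (n + 1)).hom
      ((resolutionComplex M).d (n + 1) n).hom := by
  rw [resolutionComplex_d M n, resolutionComplex_d M (n + 1)]
  exact exact_resolutionD M n

lemma exact_resolutionComplex_d_resolutionAug :
    Function.Exact ((resolutionComplex M).d 1 0).hom (resolutionAug M 0) := by
  have h := exact_resolutionD_resolutionAug M 0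
  rwa [← resolutionComplex_d M 0] at h

/-- The augmentation of the finite free resolution. -/
noncomputable def resolutionπ : (resolutionComplex M).X 0 ⟶ M :=
  ModuleCat.ofHom (resolutionAug M 0)

lemma resolutionComplex_d_comp_resolutionπ :
    (resolutionComplex M).d 1 0 ≫ resolutionπ M = 0 :=
  ModuleCat.hom_ext (exact_resolutionComplex_d_resolutionAug M).linearMap_comp_eq_zero

/-- The finite free resolution as a projective resolution. -/
noncomputable def finiteFreeResolution : ProjectiveResolution M where
  complex := resolutionComplex M
  projective n := inferInstanceAs (Projective (ModuleCat.of R (Fin (resolutionRank M n) → R)))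
  π := (ChainComplex.toSingle₀Equiv _ _).symm
    ⟨resolutionπ M, resolutionComplex_d_comp_resolutionπ M⟩
  quasiIso := ⟨fun n => by
    cases n with
    | zero =>
      rw [ChainComplex.quasiIsoAt₀_iff, ShortComplex.quasiIso_iff_of_zeros']
      · have hex : (ShortComplex.mk _ _ (resolutionComplex_d_comp_resolutionπ M)).Exact :=
          (ShortComplex.ShortExact.moduleCat_exact_iff_function_exact _).2
            (exact_resolutionComplex_d_resolutionAug M)
        have hepi : Epi (resolutionπ M) :=
          (ModuleCat.epi_iff_surjective _).2 (resolutionAug_surjective M 0)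
        refine (ShortComplex.exact_and_epi_g_iff_of_iso ?_).2 ⟨hex, hepi⟩
        exact ShortComplex.isoMk (Iso.refl _) (Iso.refl _) (Iso.refl _)
          ((Category.id_comp _).trans (Category.comp_id _).symm) (by
            simp only [Iso.refl_hom]
            exact (Category.id_comp _).trans (Category.comp_id (resolutionπ M)).symm)
      all_goals rfl
    | succ n =>
      rw [quasiIsoAt_iff_exactAt']
      · rw [HomologicalComplex.exactAt_iff' _ (n + 1 + 1) (n + 1) n (by simp) (by simp),
          ShortComplex.ShortExact.moduleCat_exact_iff_function_exact]
        exact exact_resolutionComplex_d M n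
      · apply ChainComplex.exactAt_succ_single_obj⟩

/-- Tor is the homology of `N ⊗ F` for the explicit resolution `F` of `M`. Exactness at index `n +
1` is what the two displayed differentials express. -/
lemma isZero_tor_of_exact (N : ModuleCat.{u} R) (n : ℕ)
    (h : Function.Exact ((resolutionD M (n + 1)).lTensor N) ((resolutionD M n).lTensor N)) :
    IsZero (((Tor (ModuleCat.{u} R) (n + 1)).obj N).obj M) := by
  refine IsZero.of_iso ?_
    ((finiteFreeResolution M).isoLeftDerivedObj ((MonoidalCategory.tensoringLeft _).obj N) (n + 1))
  refine HomologicalComplex.ExactAt.isZero_homology ?_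
  rw [HomologicalComplex.exactAt_iff' _ (n + 1 + 1) (n + 1) n (by simp) (by simp),
    ShortComplex.ShortExact.moduleCat_exact_iff_function_exact]
  rw [← resolutionComplex_d M n, ← resolutionComplex_d M (n + 1)] at h
  exact h

end FreeResolution

/-! ### Ext vanishing and the test property -/

section ExtLemmas

variable {R : Type u} [CommRing R]

/-- Maps out of `S.X₁` extend to `S.X₂` if `Ext¹(S.X₃, C) = 0`. -/
lemma exists_extension_of_ext_one {S : ShortComplex (ModuleCat.{u} R)} (hS : S.ShortExact)
    (C : ModuleCat.{u} R) (h : Subsingleton (Abelian.Ext S.X₃ C 1)) (φ : S.X₁ →ₗ[R] C) :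
    ∃ ψ : S.X₂ →ₗ[R] C, ψ ∘ₗ S.f.hom = φ := by
  obtain ⟨x, hx⟩ := Abelian.Ext.contravariant_sequence_exact₁ hS C
    (Abelian.Ext.mk₀ (ModuleCat.ofHom φ)) (add_zero 1) (Subsingleton.elim _ _)
  obtain ⟨ψ, rfl⟩ := (Abelian.Ext.mk₀_bijective _ _).2 x
  rw [Abelian.Ext.mk₀_comp_mk₀] at hx
  have := (Abelian.Ext.mk₀_bijective _ _).1 hx
  exact ⟨ψ.hom, congrArg ModuleCat.Hom.hom this⟩

/-- Dimension shifting: `Ext^(n+1)(S.X₃, C) = 0` gives `Extⁿ(S.X₁, C) = 0` for `n ≥ 1`, if `S.X₂`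
is projective. -/
lemma ext_X₁_subsingleton {S : ShortComplex (ModuleCat.{u} R)} (hS : S.ShortExact)
    [Projective S.X₂] (C : ModuleCat.{u} R) (n : ℕ)
    (h : Subsingleton (Abelian.Ext S.X₃ C (n + 2))) :
    Subsingleton (Abelian.Ext S.X₁ C (n + 1)) := by
  refine ⟨fun x y => ?_⟩
  have hz (x : Abelian.Ext S.X₁ C (n + 1)) : x = 0 := by
    obtain ⟨z, rfl⟩ := Abelian.Ext.contravariant_sequence_exact₁ hS C x
      (n₁ := n + 2) (by omega) (Subsingleton.elim _ _)
    rw [Abelian.Ext.eq_zero_of_projective z, Abelian.Ext.comp_zero]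
  rw [hz x, hz y]

/-- Dimension shifting: `Extⁿ(S.X₁, C) = 0` gives `Ext^(n+1)(S.X₃, C) = 0` if
`Ext^(n+1)(S.X₂, C) = 0`. -/
lemma ext_X₃_subsingleton {S : ShortComplex (ModuleCat.{u} R)} (hS : S.ShortExact)
    (C : ModuleCat.{u} R) (n : ℕ) (h₂ : Subsingleton (Abelian.Ext S.X₂ C (n + 1)))
    (h₁ : Subsingleton (Abelian.Ext S.X₁ C n)) :
    Subsingleton (Abelian.Ext S.X₃ C (n + 1)) := by
  refine ⟨fun x y => ?_⟩
  have hz (x : Abelian.Ext S.X₃ C (n + 1)) : x = 0 := by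
    obtain ⟨z, rfl⟩ := Abelian.Ext.contravariant_sequence_exact₃ hS C x
      (Subsingleton.elim _ _) (n₀ := n) (by omega)
    rw [Subsingleton.elim z 0, Abelian.Ext.comp_zero]
  rw [hz x, hz y]

variable [IsNoetherianRing R] (M : ModuleCat.{u} R) [hM : Module.Finite R M]

lemma ext_finiteSyzygy_subsingleton (C : ModuleCat.{u} R) (n : ℕ) : ∀ k : ℕ,
    Subsingleton (Abelian.Ext M C (n + k + 1)) →
      Subsingleton (Abelian.Ext (finiteSyzygy M hM n).1 C (k + 1)) := by
  induction n with
  | zero => intro k h; rwa [zero_add] at h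
  | succ n ih =>
    intro k h
    refine ext_X₁_subsingleton (freeCover_shortExact (finiteSyzygy M hM n).1) C k (ih (k + 1) ?_)
    rwa [show n + (k + 1) + 1 = n + 1 + k + 1 by omega]

/-- `Ext^(n+1)(M, C) = 0` makes `Hom(F, C)` exact in degree `n + 1`, for the finite free
resolution `F` of `M`. -/
lemma exact_lcomp_resolutionD (C : ModuleCat.{u} R) (n : ℕ)
    (h : Subsingleton (Abelian.Ext M C (n + 1))) :
    Function.Exact (LinearMap.lcomp R C (resolutionD M n))
      (LinearMap.lcomp R C (resolutionD M (n + 1))) := by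
  intro φ
  constructor
  · intro hφ
    -- A cocycle factors through the syzygy of index `n + 1`. It extends to the free module of index
    -- `n` because `Ext¹` of the syzygy of index `n` is governed by `Ext^(n+1)(M, C) = 0`.
    have hk : LinearMap.ker (resolutionAug M (n + 1)) ≤ LinearMap.ker φ := by
      intro x hx
      obtain ⟨y, rfl⟩ := (exact_resolutionD_resolutionAug M (n + 1) x).1 hx
      exact LinearMap.congr_fun hφ y
    let e := (resolutionAug M (n + 1)).quotKerEquivOfSurjective (resolutionAug_surjective M (n + 1))
    obtain ⟨ψ, hψ⟩ := exists_extension_of_ext_one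
      (freeCover_shortExact (finiteSyzygy M hM n).1) C
      (ext_finiteSyzygy_subsingleton M C n 0 h) (Submodule.liftQ _ φ hk ∘ₗ e.symm.toLinearMap)
    refine ⟨ψ, LinearMap.ext fun x => ?_⟩
    have h1 := LinearMap.congr_fun hψ (resolutionAug M (n + 1) x)
    have h2 : e.symm (resolutionAug M (n + 1) x) = Submodule.Quotient.mk x := by
      rw [LinearEquiv.symm_apply_eq]; rfl
    refine h1.trans ?_
    exact (congrArg (Submodule.liftQ _ φ hk) h2).trans (Submodule.liftQ_apply _ _ _)
  · rintro ⟨ψ, rfl⟩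
    ext x
    simp [(exact_resolutionD M n).apply_apply_eq_zero]

/-- A test module without `Tor` with `M` in high degrees forces `pd(M) < ∞`. -/
lemma IsTestModule.projectiveDimension_lt_top {T : ModuleCat.{u} R} (hT : IsTestModule T) (n : ℕ)
    (h : ∀ i, n ≤ i →
      Function.Exact ((resolutionD M (i + 1)).lTensor T) ((resolutionD M i).lTensor T)) :
    projectiveDimension M < ⊤ := by
  rw [lt_top_iff_ne_top]
  intro hpd
  refine hT.infinite_tor M hM hpd ((Set.finite_Iic n).subset fun i hi => ?_)
  by_contra hin
  rw [Set.mem_Iic, not_le] at hin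
  obtain ⟨j, rfl⟩ : ∃ j, i = j + 1 := ⟨i - 1, by omega⟩
  exact hi (isZero_tor_of_exact M T j (h j (by omega)))

/-- A test module `T` of finite injective dimension detects finite projective dimension by the
vanishing of `Ext(M, R)`. -/
lemma IsTestModule.projectiveDimension_lt_top_of_ext {T : ModuleCat.{u} R} (hT : IsTestModule T)
    {m : ℕ} (hTinj : HasInjectiveDimensionLT T (m + 1))
    (hext : ∃ n : ℕ, ∀ i : ℕ, n ≤ i → Subsingleton (Abelian.Ext M (ModuleCat.of R R) i)) :
    projectiveDimension M < ⊤ := by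
  obtain ⟨n, hn⟩ := hext
  refine hT.projectiveDimension_lt_top M n fun i hi => ?_
  -- The duality with `C = R` and `I = T`.
  refine lTensor_exact_of_exact_lcomp (LinearMap.ringLmapEquivSelf R R T).symm _ _ ?_
  let d : ∀ i, ((Fin (resolutionRank M i) → R) →ₗ[R] R) →ₗ[R]
      ((Fin (resolutionRank M (i + 1)) → R) →ₗ[R] R) :=
    fun i => LinearMap.lcomp R R (resolutionD M i)
  have hd (i : ℕ) (hi : n ≤ i) : Function.Exact (d i) (d (i + 1)) :=
    exact_lcomp_resolutionD M (ModuleCat.of R R) i (hn _ (by omega))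
  -- The test property has done its work; what remains is an induction on injective dimension
  -- through cosyzygies, which need not be test modules.
  suffices H : ∀ (m : ℕ) (T : ModuleCat.{u} R), HasInjectiveDimensionLT T (m + 1) → ∀ i, n ≤ i →
      Function.Exact (LinearMap.lcomp R T (d (i + 1))) (LinearMap.lcomp R T (d i)) from
    H m T hTinj i hi
  clear! T
  intro m
  induction m with
  | zero =>
    intro T hT i hi
    have : Module.Injective R T :=
      (Module.injective_iff_injective_object R T).2 (injective_iff_hasInjectiveDimensionLT_one.2 hT)
    exact exact_lcomp_of_injective (hd i hi)
  | succ m ih =>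
    intro T hT i hi
    let W : ModuleCat.{u} R := Injective.under T
    have hW : Injective W := inferInstanceAs (Injective (Injective.under T))
    let f : T ⟶ W := Injective.ι T
    have : Mono f := inferInstanceAs (Mono (Injective.ι T))
    let S : ShortComplex (ModuleCat.{u} R) := ShortComplex.mk f (cokernel.π f) (by simp)
    have hS : S.ShortExact := { exact := ShortComplex.exact_cokernel f }
    have hinj : Module.Injective R W := (Module.injective_iff_injective_object R W).2 hW
    have h3 : HasInjectiveDimensionLT S.X₃ (m + 1) :=
      (hS.hasInjectiveDimensionLT_X₃_iff m hW).2 hT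
    exact exact_lcomp_of_short_exact d n (f := S.f.hom) (g := S.g.hom) hd
      hS.moduleCat_injective_f ((ShortComplex.ShortExact.moduleCat_exact_iff_function_exact _).1
        hS.exact) hS.moduleCat_surjective_g
      (fun j hj => exact_lcomp_of_injective (I := W) (hd j hj)) (ih S.X₃ h3) i hi

end ExtLemmas

/-! ### Detecting projective dimension over a local ring -/

section LocalRing

variable {R : Type u} [CommRing R] [IsLocalRing R]

open IsLocalRing

/-- By Nakayama `k ⊗ C ≠ 0`, so it has a nonzero functional over the residue field `k`. -/
lemma exists_surjective_residueField (C : Type u) [AddCommGroup C] [Module R C]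
    [Module.Finite R C] [Nontrivial C] :
    ∃ q : C →ₗ[R] ResidueField R, Function.Surjective q := by
  have hne : Nontrivial (TensorProduct R (ResidueField R) C) := by
    rw [← not_subsingleton_iff_nontrivial, IsLocalRing.subsingleton_tensorProduct,
      not_subsingleton_iff_nontrivial]
    infer_instance
  obtain ⟨z, hz⟩ := exists_ne (0 : TensorProduct R (ResidueField R) C)
  obtain ⟨ξ, hξ⟩ : ∃ ξ : Module.Dual (ResidueField R) (TensorProduct R (ResidueField R) C),
      ξ z ≠ 0 := by
    by_contra! h
    exact hz ((Module.forall_dual_apply_eq_zero_iff _ z).1 h)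
  obtain ⟨c, rfl⟩ := TensorProduct.mk_surjective R C (ResidueField R) Ideal.Quotient.mk_surjective z
  refine ⟨ξ.restrictScalars R ∘ₗ TensorProduct.mk R (ResidueField R) C 1, fun y => ?_⟩
  obtain ⟨r, hr⟩ := Ideal.Quotient.mk_surjective (I := maximalIdeal R) (y / ξ (1 ⊗ₜ c))
  refine ⟨r • c, ?_⟩
  have : algebraMap R (ResidueField R) r = y / ξ (1 ⊗ₜ c) := hr
  have hξ' : ξ (TensorProduct.tmul R 1 c) ≠ 0 := hξ
  rw [map_smul, Algebra.smul_def, this]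
  exact div_mul_cancel₀ _ hξ'

/-- If every map from the projective module `K` to `C ≠ 0` extends along `f : K → F`, then
`k ⊗ f` is injective. -/
lemma lTensor_residueField_injective_of_extension (C : Type u) [AddCommGroup C] [Module R C]
    [Module.Finite R C] [Nontrivial C] {K F : Type u} [AddCommGroup K] [Module R K]
    [Module.Projective R K] [AddCommGroup F] [Module R F] (f : K →ₗ[R] F)
    (h : ∀ φ : K →ₗ[R] C, ∃ ψ : F →ₗ[R] C, ψ ∘ₗ f = φ) :
    Function.Injective (f.lTensor (ResidueField R)) := by
  obtain ⟨q, hq⟩ := exists_surjective_residueField (R := R) C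
  rw [injective_iff_map_eq_zero]
  intro z hz
  refine (Module.forall_dual_apply_eq_zero_iff (ResidueField R) z).1 fun ξ => ?_
  -- A functional on `k ⊗ K` is a map `K → k`. It lifts through `q` to `C` and then extends to `F`,
  -- so it factors through `k ⊗ f` and vanishes on `z`.
  obtain ⟨φ, hφ⟩ := Module.projective_lifting_property q
    (ξ.restrictScalars R ∘ₗ TensorProduct.mk R (ResidueField R) K 1) hq
  obtain ⟨ψ, rfl⟩ := h φ
  obtain ⟨x, rfl⟩ := TensorProduct.mk_surjective R K (ResidueField R) Ideal.Quotient.mk_surjective z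
  have h1 := congrArg (TensorProduct.lift ((LinearMap.mul R (ResidueField R)).compl₂ (q ∘ₗ ψ))) hz
  have h2 := LinearMap.congr_fun hφ x
  simp only [TensorProduct.mk_apply, LinearMap.lTensor_tmul, TensorProduct.lift.tmul,
    LinearMap.compl₂_apply, LinearMap.mul_apply', one_mul, map_zero, LinearMap.comp_apply] at h1 h2
  exact h2.symm.trans h1

variable [IsNoetherianRing R]

/-- If `pd(N) ≤ p + 1` and `Ext^(p+1)(N, C) = 0` for some finite `C ≠ 0`, then `pd(N) ≤ p`. -/
lemma hasProjectiveDimensionLT_of_ext (C : ModuleCat.{u} R) [Module.Finite R C] [Nontrivial C]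
    (p : ℕ) : ∀ (N : ModuleCat.{u} R), Module.Finite R N → HasProjectiveDimensionLT N (p + 2) →
      Subsingleton (Abelian.Ext N C (p + 1)) → HasProjectiveDimensionLT N (p + 1) := by
  induction p with
  | zero =>
    intro N _ hN hext
    have hS := freeCover_shortExact N
    have hK : HasProjectiveDimensionLT (freeCover R N).shortComplexKer.X₁ 1 :=
      (hS.hasProjectiveDimensionLT_X₃_iff 0 inferInstance).1 hN
    have : Projective (freeCover R N).shortComplexKer.X₁ :=
      projective_iff_hasProjectiveDimensionLT_one.2 hK
    have : Module.Projective R (LinearMap.ker (freeCover R N)) :=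
      (IsProjective.iff_projective (R := R) _).2 this
    -- The local criterion makes `N` itself free, not just the kernel of its cover.
    have hfree := Module.free_of_lTensor_residueField_injective
      (LinearMap.ker (freeCover R N)).subtype (freeCover R N) (freeCover_surjective (N : Type u))
      (LinearMap.exact_subtype_ker_map _)
      (lTensor_residueField_injective_of_extension C _ (exists_extension_of_ext_one hS C hext))
    exact projective_iff_hasProjectiveDimensionLT_one.1
      ((IsProjective.iff_projective (R := R) N).1 (haveI := hfree; Module.Projective.of_free))
  | succ p ih =>
    intro N _ hN hext
    have hS := freeCover_shortExact N
    rw [hS.hasProjectiveDimensionLT_X₃_iff p inferInstance]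
    refine ih _ (inferInstanceAs (Module.Finite R (LinearMap.ker (freeCover R N)))) ?_
      (ext_X₁_subsingleton hS C p hext)
    exact (hS.hasProjectiveDimensionLT_X₃_iff (p + 1) inferInstance).1 hN

lemma hasProjectiveDimensionLT_of_lt_top (C N : ModuleCat.{u} R) [Module.Finite R C]
    [Nontrivial C] [Module.Finite R N] (g : ℕ) (hN : projectiveDimension N < ⊤)
    (hext : ∀ i, g < i → Subsingleton (Abelian.Ext N C i)) : HasProjectiveDimensionLT N (g + 1) := by
  obtain ⟨n, hn⟩ := (projectiveDimension_ne_top_iff N).1 hN.ne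
  -- Any finite bound descends to `g` one unit at a time, each unit removed by one vanishing Ext.
  have H : ∀ k, HasProjectiveDimensionLT N (g + k + 1) → HasProjectiveDimensionLT N (g + 1) := by
    intro k
    induction k with
    | zero => exact id
    | succ k ih =>
      exact fun h => ih (hasProjectiveDimensionLT_of_ext C (g + k) N inferInstance h
        (hext _ (by omega)))
  exact H n (hasProjectiveDimensionLT_of_ge N (n + 1) _ (by omega))

end LocalRing

/-! ### Semidualizing modules and finite `C`-injective dimension -/

section Semidualizing

variable {R : Type u} [CommRing R]

/-- By adjunction `Hom(-, Hom(C, I)) = Hom(- ⊗ C, I)`, and `- ⊗ C` preserves injections because `C`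
is flat. -/
lemma injective_linearMap_of_projective (C I : Type u) [AddCommGroup C] [Module R C]
    [AddCommGroup I] [Module R I] [Module.Projective R C] [Module.Injective R I] :
    Module.Injective R (C →ₗ[R] I) where
  out X Y _ _ _ _ f hf g := by
    obtain ⟨h, hh⟩ := Module.Injective.out (f.rTensor C)
      (Module.Flat.rTensor_preserves_injective_linearMap f hf) (TensorProduct.lift g)
    refine ⟨TensorProduct.curry h, fun x => ?_⟩
    ext c
    simpa using hh (TensorProduct.tmul R x c)

/-- This is `Tor_i(M, C) = 0` for all `i ≥ 1`. It holds for `M = Hom(C, I)` by duality and passes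
down the coresolution. -/
lemma exact_lTensor_resolutionD_of_hasCInjectiveDimensionLE [IsNoetherianRing R]
    {C M : ModuleCat.{u} R} [Module.Finite R C]
    (hC : ∀ i : ℕ, 1 ≤ i → Subsingleton (Abelian.Ext C C i)) {n : ℕ}
    (hM : HasCInjectiveDimensionLE C M n) (i : ℕ) :
    Function.Exact ((resolutionD C (i + 1)).lTensor M) ((resolutionD C i).lTensor M) := by
  obtain ⟨I, ε, d, hI, hI0, hε, hε0, hd⟩ := hM
  revert i
  refine coresolution_induction (R := R)
    (P := fun N => ∀ i, Function.Exact ((resolutionD C (i + 1)).lTensor N)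
      ((resolutionD C i).lTensor N))
    (Q := fun W => ∃ I : ModuleCat.{u} R, Injective I ∧ Nonempty (W ≃ₗ[R] (C →ₗ[R] I)))
    -- Length `n` means that the terms vanish from index `n + 1` on.
    ?_ ?_ (n + 1) M (fun i => ModuleCat.of R (C →ₗ[R] I i)) ε d
    (fun i => ⟨I i, hI i, ⟨LinearEquiv.refl R _⟩⟩) ?_ hε hε0 hd
  · intro N hN i x
    exact ⟨fun _ => ⟨0, Subsingleton.elim _ _⟩, fun _ => Subsingleton.elim _ _⟩
  · rintro N W N' f g hf hfg hg ⟨J, hJ, ⟨e⟩⟩ hN'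
    have : Module.Injective R J := (Module.injective_iff_injective_object R J).2 hJ
    exact exact_lTensor_of_short_exact (F := fun i => Fin (resolutionRank C i) → R)
      (resolutionD C) (exact_resolutionD C) hf hfg hg
      (fun i => lTensor_exact_of_exact_lcomp e _ _ (exact_lcomp_of_injective
        (exact_lcomp_resolutionD C C i (hC _ (by omega))))) hN'
  · intro i hi
    have := hI0 i (by omega)
    exact inferInstanceAs (Subsingleton (C →ₗ[R] I i))

lemma exists_hasInjectiveDimensionLT_of_hasCInjectiveDimensionLE {C M : ModuleCat.{u} R}
    [Module.Projective R C] {n : ℕ} (hM : HasCInjectiveDimensionLE C M n) :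
    ∃ m, HasInjectiveDimensionLT M (m + 1) := by
  obtain ⟨I, ε, d, hI, hI0, hε, hε0, hd⟩ := hM
  refine coresolution_induction (R := R)
    (P := fun N => ∃ m, HasInjectiveDimensionLT N (m + 1)) (Q := fun W => Injective W)
    ?_ ?_ (n + 1) M (fun i => ModuleCat.of R (C →ₗ[R] I i)) ε d ?_ ?_ hε hε0 hd
  · intro N hN
    have := (ModuleCat.isZero_of_subsingleton N).hasInjectiveDimensionLT_zero
    exact ⟨0, hasInjectiveDimensionLT_of_ge N 0 1 (by omega)⟩
  · rintro N W N' f g hf hfg hg hW ⟨m, hm⟩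
    have hS := ModuleCat.shortComplex_shortExact
      (ShortComplex.mk (ModuleCat.ofHom f) (ModuleCat.ofHom g)
        (ModuleCat.hom_ext hfg.linearMap_comp_eq_zero)) hfg hf hg
    exact ⟨m + 1, hS.hasInjectiveDimensionLT_X₁ (m + 1) hm
      (hasInjectiveDimensionLT_of_ge W 1 (m + 1 + 1) (by omega))⟩
  · intro i
    have : Module.Injective R (I i) := (Module.injective_iff_injective_object R (I i)).2 (hI i)
    have := injective_linearMap_of_projective (R := R) C (I i)
    exact Module.injective_object_of_injective_module R (C →ₗ[R] I i)
  · intro i hi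
    have := hI0 i (by omega)
    exact inferInstanceAs (Subsingleton (C →ₗ[R] I i))

lemma IsSemidualizing.nontrivial [Nontrivial R] {C : ModuleCat.{u} R} (hC : IsSemidualizing C) :
    Nontrivial C := by
  rw [← not_subsingleton_iff_nontrivial]
  intro h
  exact one_ne_zero (hC.bijective_homothety.1 (Subsingleton.elim (LinearMap.lsmul R C 1)
    (LinearMap.lsmul R C 0)))

/-- A semidualizing module `C` is projective if some test module has finite `C`-injective
dimension. -/
lemma IsSemidualizing.projective_of_isTestModule [IsLocalRing R] [IsNoetherianRing R]
    {C M : ModuleCat.{u} R} (hC : IsSemidualizing C) (hM : IsTestModule M) {n : ℕ}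
    (hCM : HasCInjectiveDimensionLE C M n) : Module.Projective R C := by
  have := hC.finite
  have := hC.nontrivial
  have hpd := hM.projectiveDimension_lt_top C 0 fun i _ =>
    exact_lTensor_resolutionD_of_hasCInjectiveDimensionLE hC.ext_vanishing hCM i
  have := hasProjectiveDimensionLT_of_lt_top C C 0 hpd hC.ext_vanishing
  exact (IsProjective.iff_projective (R := R) C).2
    (projective_iff_hasProjectiveDimensionLT_one.2 this)

end Semidualizing

/-! ### Gorenstein dimension -/

section GDimension

variable {R : Type u} [CommRing R]

lemma isTotallyReflexive_of_projective (M : ModuleCat.{u} R) [Module.Finite R M]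
    [Module.Projective R M] : IsTotallyReflexive M where
  finite := inferInstance
  bijective_biduality := Module.bijective_dual_eval R M
  ext_vanishing i hi := by
    obtain ⟨j, rfl⟩ : ∃ j, i = j + 1 := ⟨i - 1, by omega⟩
    have : Projective M := M.projective_of_categoryTheory_projective
    exact Abelian.Ext.subsingleton_of_projective _ _ _
  ext_dual_vanishing i hi := by
    obtain ⟨j, rfl⟩ : ∃ j, i = j + 1 := ⟨i - 1, by omega⟩
    have : Projective (ModuleCat.of R (Module.Dual R M)) :=
      (IsProjective.iff_projective (R := R) _).1 inferInstance
    exact Abelian.Ext.subsingleton_of_projective _ _ _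

lemma HasGDimensionLE.of_projective (M : ModuleCat.{u} R) [Module.Finite R M]
    [Module.Projective R M] : HasGDimensionLE M 0 := by
  let X : ℕ → ModuleCat.{u} R := fun | 0 => M | _ + 1 => ModuleCat.of R PUnit
  refine ⟨X, LinearMap.id, fun _ => 0, ?_, ?_, Function.surjective_id, ?_, ?_⟩
  · rintro (_ | i)
    · exact isTotallyReflexive_of_projective M
    · exact isTotallyReflexive_of_projective (ModuleCat.of R PUnit)
  · rintro (_ | i) hi
    · omega
    · exact inferInstanceAs (Subsingleton PUnit)
  · intro x
    exact ⟨fun h => ⟨0, h.symm⟩, by rintro ⟨y, rfl⟩; rfl⟩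
  · intro i x
    exact ⟨fun _ => ⟨0, @Subsingleton.elim PUnit _ _ _⟩,
      fun _ => rfl⟩

lemma HasGDimensionLE.succ {K F M : ModuleCat.{u} R} {f : K →ₗ[R] F} {g : F →ₗ[R] M} {n : ℕ}
    (hf : Function.Injective f) (hfg : Function.Exact f g) (hg : Function.Surjective g)
    (hF : IsTotallyReflexive F) (hK : HasGDimensionLE K n) : HasGDimensionLE M (n + 1) := by
  obtain ⟨X, ε, d, hX, hX0, hε, hdε, hd⟩ := hK
  let Y : ℕ → ModuleCat.{u} R := fun | 0 => F | i + 1 => X i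
  let δ : ∀ i, Y (i + 1) →ₗ[R] Y i := fun | 0 => f ∘ₗ ε | i + 1 => d i
  refine ⟨Y, g, δ, ?_, ?_, hg, ?_, ?_⟩
  · rintro (_ | i)
    · exact hF
    · exact hX i
  · rintro (_ | i) hi
    · omega
    · exact hX0 i (by omega)
  · intro x
    change _ ↔ x ∈ Set.range (f ∘ ε)
    rw [hε.range_comp]
    exact hfg x
  · rintro (_ | i)
    · intro x
      change f (ε x) = 0 ↔ _
      rw [map_eq_zero_iff f hf]
      exact hdε x
    · exact hd i

lemma HasGDimensionLE.of_hasProjectiveDimensionLT [IsNoetherianRing R] (n : ℕ) :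
    ∀ M : ModuleCat.{u} R, Module.Finite R M → HasProjectiveDimensionLT M (n + 1) →
      HasGDimensionLE M n := by
  induction n with
  | zero =>
    intro M _ hM
    have : Module.Projective R M := (IsProjective.iff_projective (R := R) M).2
      (projective_iff_hasProjectiveDimensionLT_one.2 hM)
    exact .of_projective M
  | succ n ih =>
    intro M _ hM
    have hS := freeCover_shortExact M
    refine HasGDimensionLE.succ (K := (freeCover R M).shortComplexKer.X₁)
      (F := ModuleCat.of R (Fin (coverRank R M) → R))
      (f := (LinearMap.ker (freeCover R M)).subtype) (g := freeCover R M)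
      (Submodule.subtype_injective _) (LinearMap.exact_subtype_ker_map _)
      (freeCover_surjective (M : Type u)) (isTotallyReflexive_of_projective _) (ih _
        (inferInstanceAs (Module.Finite R (LinearMap.ker (freeCover R M)))) ?_)
    exact (hS.hasProjectiveDimensionLT_X₃_iff n inferInstance).1 hM

lemma ext_subsingleton_of_subsingleton {M : ModuleCat.{u} R} [Subsingleton M] (N : ModuleCat.{u} R)
    (i : ℕ) : Subsingleton (Abelian.Ext M N i) :=
  have := (ModuleCat.isZero_of_subsingleton M).hasProjectiveDimensionLT_zero
  HasProjectiveDimensionLT.subsingleton M 0 i (Nat.zero_le i) N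

/-- Dimension shifting: the totally reflexive `X 0` has no higher Ext into `R`, so the question
passes to the kernel of `ε`. Here `n` counts the possibly nonzero terms, one more than the length,
so that the induction starts at `M = 0`. -/
lemma ext_subsingleton_of_resolution (n : ℕ) : ∀ (M : ModuleCat.{u} R) (X : ℕ → ModuleCat.{u} R)
    (ε : X 0 →ₗ[R] M) (d : ∀ i : ℕ, X (i + 1) →ₗ[R] X i),
    (∀ i, IsTotallyReflexive (X i)) → (∀ i, n ≤ i → Subsingleton (X i)) →
    Function.Surjective ε → Function.Exact (d 0) ε → (∀ i, Function.Exact (d (i + 1)) (d i)) →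
    ∀ i, n ≤ i → Subsingleton (Abelian.Ext M (ModuleCat.of R R) i) := by
  induction n with
  | zero =>
    intro M X ε d _ h0 hε _ _ i _
    have := h0 0 le_rfl
    have := hε.subsingleton
    exact ext_subsingleton_of_subsingleton _ i
  | succ n ih =>
    intro M X ε d hX h0 hε hdε hd i hi
    obtain ⟨j, rfl⟩ : ∃ j, i = j + 1 := ⟨i - 1, by omega⟩
    refine ext_X₃_subsingleton (LinearMap.shortExact_shortComplexKer hε) _ j
      ((hX 0).ext_vanishing _ (by omega)) ?_
    have hk (x) : d 0 x ∈ LinearMap.ker ε := hdε.apply_apply_eq_zero x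
    refine ih _ (fun i => X (i + 1)) ((d 0).codRestrict (LinearMap.ker ε) hk)
      (fun i => d (i + 1)) (fun i => hX _) (fun i hi => h0 _ (by omega)) ?_ ?_ (fun i => hd _) j
      (by omega)
    · rintro ⟨x, hx⟩
      obtain ⟨y, rfl⟩ := (hdε x).1 hx
      exact ⟨y, rfl⟩
    · intro x
      rw [← hd 0 x, ← Subtype.coe_inj]
      rfl

lemma HasGDimensionLE.ext_subsingleton {M : ModuleCat.{u} R} {n : ℕ} (h : HasGDimensionLE M n)
    (i : ℕ) (hi : n < i) : Subsingleton (Abelian.Ext M (ModuleCat.of R R) i) := by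
  obtain ⟨X, ε, d, hX, hX0, hε, hdε, hd⟩ := h
  exact ext_subsingleton_of_resolution (n + 1) M X ε d hX hX0 hε hdε hd i hi

lemma gDimension_le_iff {M : ModuleCat.{u} R} [Nontrivial M] {n : ℕ} :
    gDimension M ≤ n ↔ ∃ m ≤ n, HasGDimensionLE M m := by
  rw [gDimension, if_neg (not_subsingleton_iff_nontrivial.2 inferInstance)]
  constructor
  · intro h
    by_contra! H
    -- If no admissible length is at most `n`, the infimum is at least `n + 1`, even when it is over
    -- the empty set.
    have h1 : ((n + 1 : ℕ) : ℕ∞) ≤ ⨅ (k : ℕ) (_ : HasGDimensionLE M k), (k : ℕ∞) :=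
      le_iInf₂ fun k hk => Nat.cast_le.2 (by
        by_contra hlt
        exact H k (by omega) hk)
    have h2 := h1.trans (WithBot.coe_le_coe.1 h)
    have := Nat.cast_le.1 h2
    omega
  · rintro ⟨m, hm, hG⟩
    exact WithBot.coe_le_coe.2 ((iInf₂_le m hG).trans (Nat.cast_le.2 hm))

/-- Over a local ring with a test module of finite injective dimension, `G-dim = pd`. -/
lemma IsTestModule.isGRegular [IsLocalRing R] [IsNoetherianRing R] {T : ModuleCat.{u} R}
    (hT : IsTestModule T) {m : ℕ} (hTinj : HasInjectiveDimensionLT T (m + 1)) : IsGRegular R := by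
  intro M _
  by_cases hM : Subsingleton M
  · rw [gDimension, if_pos hM, eq_comm, projectiveDimension_eq_bot_iff]
    exact ModuleCat.isZero_of_subsingleton M
  have : Nontrivial M := not_subsingleton_iff_nontrivial.1 hM
  -- The two dimensions are compared through their upper bounds, so no case split on finiteness is
  -- needed; only natural bounds carry content.
  refine eq_of_forall_ge_iff fun N => ?_
  induction N with
  | bot =>
    rw [le_bot_iff, le_bot_iff, projectiveDimension_eq_bot_iff,
      ModuleCat.isZero_iff_subsingleton, gDimension, if_neg hM]
    simp [hM]
  | coe N =>
    induction N with
    | top => simp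
    | coe n =>
      change gDimension M ≤ (n : WithBot ℕ∞) ↔ projectiveDimension M ≤ (n : WithBot ℕ∞)
      rw [gDimension_le_iff, projectiveDimension_le_iff]
      constructor
      · rintro ⟨k, hk, hG⟩
        have hext := hG.ext_subsingleton
        have hpd := hT.projectiveDimension_lt_top_of_ext M hTinj ⟨k + 1, fun i hi => hext i hi⟩
        have := hasProjectiveDimensionLT_of_lt_top (ModuleCat.of R R) M k hpd hext
        exact hasProjectiveDimensionLT_of_ge M (k + 1) (n + 1) (by omega)
      · intro h
        exact ⟨n, le_rfl, .of_hasProjectiveDimensionLT n M inferInstance h⟩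

end GDimension

theorem mainTheorem9 (R : Type u) [CommRing R] [IsLocalRing R] [IsNoetherianRing R] :
    (∀ C M : ModuleCat.{u} R, IsSemidualizing C → Nontrivial M → IsTestModule M →
      cInjectiveDimension C M < ⊤ →
      ∀ X : ModuleCat.{u} R, Module.Finite R X →
        (∃ n : ℕ, ∀ i : ℕ, n ≤ i → Subsingleton (Abelian.Ext X (ModuleCat.of R R) i)) →
        projectiveDimension X < ⊤) ∧
    ((∃ M : ModuleCat.{u} R, Nontrivial M ∧ IsTestModule M ∧ injectiveDimension M < ⊤) →
      IsGRegular R) := by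
  constructor
  · intro C M hC _ hM hCM X _ hX
    obtain ⟨n, hn⟩ : ∃ n, HasCInjectiveDimensionLE C M n := by
      -- Otherwise the infimum defining the dimension is over the empty set and equals `⊤`.
      by_contra! h
      simp [cInjectiveDimension, h] at hCM
    have := hC.projective_of_isTestModule hM hn
    obtain ⟨m, hm⟩ := exists_hasInjectiveDimensionLT_of_hasCInjectiveDimensionLE hn
    exact hM.projectiveDimension_lt_top_of_ext X hm hX
  · rintro ⟨M, _, hM, hid⟩
    obtain ⟨m, hm⟩ := (injectiveDimension_ne_top_iff M).1 hid.ne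
    exact hM.isGRegular hm
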